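/- A spherical tangle diagram is a tangle diagram in a planar annulus with four endpoints on the inner and four endpoints on the outer boundary circle, at the same four directions NE, NW, SW, SE (closed components are allowed). Such diagrams are taken in general position with respect to polar coordinates, and they are recorded by the sequence, from the inside to the outside, of their crossings, local minima and maxima of the radius, and passages through a fixed ray from the centre. $S_2\circ S_1$ is the diagram obtained by putting $S_1$ into the hole of $S_2$. With this composition the set $\mathbf{ST}$ of spherical tangle diagrams is a monoid, whose identity $\mathbf I$ consists of four radial strands. For a link diagram $L$ let $$\langle L\rangle=\sum_{\sigma}A^{\alpha(\sigma)}A^{-\beta(\sigma)}(-A^2-A^{-2})^{d(\sigma)-1},\qquad A=e^{i\pi/4},$$ be its Kauffman bracket, where $\sigma$ runs over all states of $L$, $\alpha(\sigma)$ and $\beta(\sigma)$ are the numbers of $A$- and $B$-splittings of $\sigma$, and $d(\sigma)$ is the number of circles of the resolved diagram. For $S\in\mathbf{ST}$ and $k,j\in\{1,2\}$ let $S_{kj}$ be the link diagram obtained by filling the hole of $S$ with the fundamental tangle $j$ (for $j=1$ the two vertical arcs NW–SW and NE–SE, for $j=2$ the two horizontal arcs NW–NE and SW–SE) and then taking the numerator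 closure ($k=1$, joining NW to NE and SW to SE outside) or the denominator closure ($k=2$, joining NW to SW and NE to SE outside). Let $PM_{2\times2}(\mathbb Z)$ be the monoid of $2\times 2$ integer matrices modulo multiplication by $\pm1$, and put $$F(S)=\left\{z\begin{pmatrix}\langle S_{11}\rangle & -i\langle S_{12}\rangle\\ i\langle S_{21}\rangle & \langle S_{22}\rangle\end{pmatrix}\ :\ z\in\mathbb C,\ z^8=1\right\}\cap M_{2\times 2}(\mathbb Z).$$ Lemma. For every $S\in\mathbf{ST}$ the set $F(S)$ has the form $\{M,-M\}$, so that $F(S)$ is an element of $PM_{2\times2}(\mathbb Z)$. For all $S_1,S_2\in\mathbf{ST}$, $$F(S_2\circ S_1)=F(S_2)\,F(S_1)\quad\text{in } PM_{2\times2}(\mathbb Z).$$ Moreover $F(\mathbf I)=[\,\mathrm{Id}\,]$, so $F:\mathbf{ST}\to PM_{2\times2}(\mathbb Z)$ is a monoid homomorphism. -/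

import Mathlib

/-!
Spherical tangle diagrams, the Kauffman bracket at `A = exp(iπ/4)`, and the invariant `F`.

A diagram of a 1-punctured ball tangle lives in a planar annulus around a round hole.  Every such
diagram, after an arbitrarily small planar isotopy fixing the boundary, is in general position with
respect to polar coordinates: crossings, local extrema of the radius, and passages through a fixed
base ray (a ray from the centre that avoids the endpoints) occur at pairwise distinct radii.  Such a
diagram is recorded faithfully by the sequence of these events, read from the inside to the outside.
Between two events, the diagram meets a concentric circle in finitely many points; they are
numbered `0, 1, 2, …` counterclockwise, starting from the base ray.
-/

namespace BallTangle

/-- Which strand of a crossing is the upper one: the one that turns clockwise when it is followed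
outwards (`cw`), or the one that turns counterclockwise (`ccw`). -/
inductive OverStrand
  | cw
  | ccw

/-- An elementary annular slice with `n` endpoints on its inner circle and `m` on its outer one.
* `cup n i`: a local minimum of the radius; creates the adjacent outer points `i`, `i + 1`.
* `cap n i`: a local maximum of the radius; joins the adjacent inner points `i`, `i + 1`.
* `crossing n i o`: the strands starting at the inner points `i` and `i + 1` cross each other.
* `rot n`: the last strand passes the base ray counterclockwise, so `j` becomes `j + 1` mod `n`.
* `rotInv n`: the first strand passes the base ray clockwise, so `j` becomes `j - 1` mod `n`. -/
inductive Slice : ℕ → ℕ → Type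
  | cup (n : ℕ) (i : Fin (n + 1)) : Slice n (n + 2)
  | cap (n : ℕ) (i : Fin (n + 1)) : Slice (n + 2) n
  | crossing (n : ℕ) (i : Fin (n + 1)) (o : OverStrand) : Slice (n + 2) (n + 2)
  | rot (n : ℕ) : Slice n n
  | rotInv (n : ℕ) : Slice n n

/-- Annular tangle diagrams with `n` endpoints on the inner and `m` endpoints on the outer circle:
finite sequences of slices, from the inside to the outside. -/
inductive Diagram : ℕ → ℕ → Type
  | nil (n : ℕ) : Diagram n n
  | cons {n m k : ℕ} (s : Slice n m) (D : Diagram m k) : Diagram n k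

/-- A link diagram in the plane is a diagram without endpoints. -/
abbrev LinkDiagram : Type := Diagram 0 0

namespace Diagram

/-- The diagram consisting of one slice. -/
def single {n m : ℕ} (s : Slice n m) : Diagram n m := cons s (nil m)

/-- `glue D E` places `D` inside `E`; the outer circle of `D` is the inner circle of `E`. -/
def glue : {n m k : ℕ} → Diagram n m → Diagram m k → Diagram n k
  | _, _, _, nil _, E => E
  | _, _, _, cons s D, E => cons s (glue D E)

theorem glue_nil {n m : ℕ} (D : Diagram n m) : glue D (nil m) = D := by
  induction D with
  | nil n => rfl
  | cons s D ih => simp [glue, ih]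

theorem glue_assoc {n m k l : ℕ} (D : Diagram n m) (E : Diagram m k) (G : Diagram k l) :
    glue (glue D E) G = glue D (glue E G) := by
  induction D with
  | nil n => rfl
  | cons s D ih => simp [glue, ih]

end Diagram

/-! ### Strands and circles -/

/-- `s.Arc a b`: the endpoints `a` and `b` of the slice `s` are the two ends of one of its arcs.
Here `Sum.inl` marks points of the inner circle and `Sum.inr` points of the outer circle. (Each arc
is recorded in one direction only.) -/
def Slice.Arc : {n m : ℕ} → Slice n m → Fin n ⊕ Fin m → Fin n ⊕ Fin m → Prop
  | _, _, .cup _ i, .inl j, .inr k => k.val = if j.val < i.val then j.val else j.val + 2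
  | _, _, .cup _ i, .inr k, .inr l => k.val = i.val ∧ l.val = i.val + 1
  | _, _, .cap _ i, .inl j, .inr k => j.val = if k.val < i.val then k.val else k.val + 2
  | _, _, .cap _ i, .inl j, .inl l => j.val = i.val ∧ l.val = i.val + 1
  | _, _, .crossing _ i _, .inl j, .inr k =>
      k.val = if j.val = i.val then i.val + 1 else if j.val = i.val + 1 then i.val else j.val
  | _, _, .rot n, .inl j, .inr k => k.val = (j.val + 1) % n
  | _, _, .rotInv n, .inl j, .inr k => j.val = (k.val + 1) % n
  | _, _, _, _, _ => False

namespace Diagram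

/-- The points in which a diagram meets the concentric circles bounding its slices. -/
def Points : {n m : ℕ} → Diagram n m → Type
  | n, _, nil _ => Fin n
  | n, _, cons _ D => Fin n ⊕ Points D

/-- The points on the innermost circle. -/
def start : {n m : ℕ} → (D : Diagram n m) → Fin n → D.Points
  | _, _, nil _, j => j
  | _, _, cons _ _, j => Sum.inl j

/-- Two points of a diagram are the two ends of an arc of one of its slices. -/
def Arc : {n m : ℕ} → (D : Diagram n m) → D.Points → D.Points → Prop
  | _, _, nil _ => fun _ _ => False
  | _, _, cons s D => fun x y =>
      (∃ a b, s.Arc a b ∧ x = Sum.map id D.start a ∧ y = Sum.map id D.start b) ∨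
      (∃ x' y', D.Arc x' y' ∧ x = Sum.inr x' ∧ y = Sum.inr y')

/-- The number of connected components of the curve obtained by joining all arcs of all slices.
For a link diagram without crossings this is its number of circles. -/
noncomputable def numCircles {n m : ℕ} (D : Diagram n m) : ℕ := Nat.card (Quot D.Arc)

end Diagram

/-! ### States and the Kauffman bracket -/

/-- The two types of splitting of a crossing. -/
inductive Splitting
  | A
  | B
  deriving DecidableEq

instance Splitting.instFintype : Fintype Splitting where
  elems := {Splitting.A, Splitting.B}
  complete x := by cases x <;> simp

/-- The crossings of a slice. -/
def Slice.Crossings : {n m : ℕ} → Slice n m → Type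
  | _, _, .crossing _ _ _ => Unit
  | _, _, _ => Empty

/-- The crossings of a diagram. -/
def Diagram.Crossings : {n m : ℕ} → Diagram n m → Type
  | _, _, .nil _ => Empty
  | _, _, .cons s D => s.Crossings ⊕ Crossings D

instance Slice.instDecidableEqCrossings {n m : ℕ} (s : Slice n m) : DecidableEq s.Crossings := by
  cases s <;> unfold Slice.Crossings <;> infer_instance

instance Slice.instFintypeCrossings {n m : ℕ} (s : Slice n m) : Fintype s.Crossings := by
  cases s <;> unfold Slice.Crossings <;> infer_instance

instance Diagram.instDecidableEqCrossings :
    {n m : ℕ} → (D : Diagram n m) → DecidableEq D.Crossings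
  | _, _, .nil _ => inferInstanceAs (DecidableEq Empty)
  | _, _, .cons s D =>
      letI := Diagram.instDecidableEqCrossings D
      inferInstanceAs (DecidableEq (s.Crossings ⊕ D.Crossings))

instance Diagram.instFintypeCrossings : {n m : ℕ} → (D : Diagram n m) → Fintype D.Crossings
  | _, _, .nil _ => inferInstanceAs (Fintype Empty)
  | _, _, .cons s D =>
      letI := Diagram.instFintypeCrossings D
      inferInstanceAs (Fintype (s.Crossings ⊕ D.Crossings))

/-- A state of a diagram chooses a splitting for each crossing. -/
abbrev Diagram.State {n m : ℕ} (D : Diagram n m) : Type := D.Crossings → Splitting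

/-- The result of splitting a slice.  The `A`-regions of a crossing are the two regions swept out
when the upper strand is rotated counterclockwise; an `A`-splitting opens a channel between these,
a `B`-splitting opens a channel between the other two.  If the upper strand turns clockwise, the
`A`-regions are the innermost and the outermost of the four regions, so the `A`-splitting leaves two
radial strands and the `B`-splitting leaves a cap followed by a cup.  If the upper strand turns
counterclockwise it is the other way round. -/
def Slice.split : {n m : ℕ} → (s : Slice n m) → (s.Crossings → Splitting) → Diagram n m
  | _, _, .crossing n i o, σ =>
      match o, σ () with
      | .cw, .A => .nil (n + 2)
      | .cw, .B => .cons (.cap n i) (.single (.cup n i))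
      | .ccw, .A => .cons (.cap n i) (.single (.cup n i))
      | .ccw, .B => .nil (n + 2)
  | _, _, .cup n i, _ => .single (.cup n i)
  | _, _, .cap n i, _ => .single (.cap n i)
  | _, _, .rot n, _ => .single (.rot n)
  | _, _, .rotInv n, _ => .single (.rotInv n)

/-- The crossingless diagram obtained by applying a state. -/
def Diagram.resolve : {n m : ℕ} → (D : Diagram n m) → D.State → Diagram n m
  | _, _, .nil n, _ => .nil n
  | _, _, .cons s D, σ => (s.split fun c => σ (.inl c)).glue (D.resolve fun c => σ (.inr c))

/-- The Kauffman bracket `⟨L⟩_A`: the sum over all states `σ` of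
`A ^ α(σ) * (A⁻¹) ^ β(σ) * (-A² - A⁻²) ^ (d(σ) - 1)`, where `α(σ)` and `β(σ)` count the `A`- and
`B`-splittings of `σ`, and `d(σ)` is the number of circles of the resolved diagram.  (The truncated
subtraction only matters for the empty link.) -/
noncomputable def kauffmanBracket (A : ℂ) (L : LinkDiagram) : ℂ :=
  ∑ σ : L.State,
    A ^ Fintype.card {c : L.Crossings // σ c = Splitting.A} *
    A⁻¹ ^ Fintype.card {c : L.Crossings // σ c = Splitting.B} *
    (-A ^ 2 - A⁻¹ ^ 2) ^ ((L.resolve σ).numCircles - 1)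

/-- The Kauffman bracket at `A = exp(iπ/4)`. -/
noncomputable def bracket (L : LinkDiagram) : ℂ :=
  kauffmanBracket (Complex.exp (Real.pi * Complex.I / 4)) L

/-! ### Spherical tangles -/

/-- Spherical tangle diagrams: four endpoints on the inner and four on the outer circle.  In the
counterclockwise numbering from the (eastern) base ray, `0, 1, 2, 3` are the north-eastern,
north-western, south-western and south-eastern endpoint. -/
def ST : Type := Diagram 4 4

/-- The composition `S₂ ∘ S₁`: the diagram `S₁` is put into the hole of `S₂`. -/
def ST.comp (S₂ S₁ : ST) : ST := Diagram.glue S₁ S₂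

/-- The identity spherical tangle: four radial strands. -/
def ST.id : ST := Diagram.nil 4

/-- Spherical tangle diagrams form a monoid under composition. -/
instance ST.instMonoid : Monoid ST where
  mul := ST.comp
  one := ST.id
  mul_assoc S₃ S₂ S₁ := (Diagram.glue_assoc S₁ S₂ S₃).symm
  one_mul S := Diagram.glue_nil S
  mul_one _ := rfl

/-- The fundamental ball tangles: `0` is the first one, consisting of two vertical arcs
(NW to SW and NE to SE), and `1` is the second one, consisting of two horizontal arcs
(NE to NW and SW to SE). -/
def fundamentalTangle : Fin 2 → Diagram 0 4
  | 0 => .cons (.cup 0 0) (.cons (.cup 2 2) (.single (.rot 4)))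
  | 1 => .cons (.cup 0 0) (.single (.cup 2 2))

/-- The closing arcs outside of the ball: `0` is the numerator closure (NE to NW and SW to SE), and
`1` is the denominator closure (NW to SW and SE to NE). -/
def closingArcs : Fin 2 → Diagram 4 0
  | 0 => .cons (.cap 2 2) (.single (.cap 0 0))
  | 1 => .cons (.rot 4) (.cons (.cap 2 2) (.single (.cap 0 0)))

/-- The link diagram obtained from `S` by filling its hole with the fundamental tangle `j` and
taking the numerator (`k = 0`) or denominator (`k = 1`) closure. -/
def ST.link (S : ST) (k j : Fin 2) : LinkDiagram :=
  (fundamentalTangle j).glue (Diagram.glue S (closingArcs k))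

/-! ### The invariant -/

/-- The congruence on square integer matrices that identifies `M` with `-M`. -/
def signCon : Con (Matrix (Fin 2) (Fin 2) ℤ) where
  r M N := M = N ∨ M = -N
  iseqv :=
    { refl := fun _ => Or.inl rfl
      symm := by
        rintro M N (h | h)
        · exact Or.inl h.symm
        · exact Or.inr (by rw [h, neg_neg])
      trans := by
        rintro M N P (rfl | rfl) (rfl | rfl) <;> simp }
  mul' := by
    rintro M N P Q (rfl | rfl) (rfl | rfl) <;> simp

/-- `PM_{2×2}(ℤ)`, the integer `2 × 2` matrices modulo `±1`, with the induced multiplication. -/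
abbrev PM : Type := signCon.Quotient

/-- An element of `PM_{2×2}(ℤ)` regarded as a set of integer matrices, of the form `{M, -M}`. -/
def PM.toSet (P : PM) : Set (Matrix (Fin 2) (Fin 2) ℤ) :=
  {M | Con.toQuotient (c := signCon) M = P}

/-- The complex matrix whose multiples by eighth roots of unity enter the definition of `F`. -/
noncomputable def ST.bracketMatrix (S : ST) : Matrix (Fin 2) (Fin 2) ℂ :=
  !![bracket (S.link 0 0), -Complex.I * bracket (S.link 0 1);
     Complex.I * bracket (S.link 1 0), bracket (S.link 1 1)]

/-- The set of all integer matrices among the multiples of the bracket matrix by eighth roots of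
unity. -/
def ST.invariantSet (S : ST) : Set (Matrix (Fin 2) (Fin 2) ℤ) :=
  {M | ∃ z : ℂ, z ^ 8 = 1 ∧ M.map (fun a : ℤ => (a : ℂ)) = z • S.bracketMatrix}

/-- The spherical tangle invariant `F(S)`: the element of `PM_{2×2}(ℤ)` which, as a set of integer
matrices `{M, -M}`, is the invariant set of `S`. -/
noncomputable def F (S : ST) : PM :=
  Classical.epsilon fun P : PM => P.toSet = S.invariantSet

end BallTangle

namespace BallTangle

open Equiv

/-! ### Matchings between even and odd points -/

/-! At `A = exp(iπ/4)` the loop value `-A² - A⁻²` is `0`, so only states with a single circle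
contribute, and `A⁻¹ = -iA`. Arcs of crossingless diagrams join points of opposite parity, so a
matching of the endpoints is a permutation; together with a number of closed circles it forms a
`LoopState`. The state sum of a diagram is a linear map from functions of the inner loop state to
functions of the outer one, and gluing becomes composition (`Diagram.stateSum_glue`).

Multiplicativity: for four points there are only two permutations. Since the loop value vanishes,
filling the hole with a fundamental tangle yields the indicator of a circle-free state
(`stateSum_fundamentalTangle`). The span of the two indicators is preserved by every state sum
(`ST.stateSum_indicator`), so the brackets are matrix coefficients and compose as such; the factors
`∓i` are a conjugation by `diag(1, i)`.

Integrality: the sign of the permutation times `(-1)` to the number of circles changes by a constant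
under each crossingless slice, and by `-1` between the two splittings of a crossing
(`sign_act_cup_act_cap`). As `A⁻¹ = -iA`, the two terms at a crossing then have the same phase up to
sign, so `HasPhase` propagates and the bracket matrix is an eighth root of unity times an integer
matrix. Two nonzero integer matrices whose ratio is an eighth root of unity differ by a sign. -/

/-- `⌊n / 2⌋`, by a recursion which makes `half (n + 2)` unfold to `half n + 1`. -/
def half : ℕ → ℕ
  | 0 => 0
  | 1 => 0
  | n + 2 => half n + 1

/-- The extension of a permutation of `Fin h` to the natural numbers by the identity. -/
def extend {h : ℕ} (σ : Perm (Fin h)) (x : ℕ) : ℕ :=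
  if hx : x < h then σ ⟨x, hx⟩ else x

theorem extend_of_lt {h : ℕ} (σ : Perm (Fin h)) {x : ℕ} (hx : x < h) :
    extend σ x = σ ⟨x, hx⟩ := dif_pos hx

theorem extend_inv_apply {h : ℕ} (σ : Perm (Fin h)) (z : Fin h) : extend σ⁻¹ (σ z) = z := by
  simp [extend]

theorem extend_injective {h : ℕ} (σ : Perm (Fin h)) : Function.Injective (extend σ) := by
  intro x y hxy
  unfold extend at hxy
  split_ifs at hxy with hx hy hy
  · have := σ.injective (Fin.ext hxy)
    simpa using this
  · have := (σ ⟨x, hx⟩).isLt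
    omega
  · have := (σ ⟨y, hy⟩).isLt
    omega
  · exact hxy

/-- A permutation `π` of `Fin h` encodes the matching of the points `0, …, 2 * h - 1` that joins
`2 * a` to `2 * π a + 1`.  The arc of this matching at the point `j` has the label `label π j`. -/
def label {h : ℕ} (π : Perm (Fin h)) (j : ℕ) : ℕ :=
  if j % 2 = 0 then j / 2 else extend π⁻¹ (j / 2)

/-- The matching in which `j` plays the role of `j + 1` in `π`. -/
def turn {h : ℕ} (π : Perm (Fin h)) : Perm (Fin h) := (finRotate h)⁻¹ * π⁻¹

/-- The inverse of `turn`. -/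
def turnBack {h : ℕ} (π : Perm (Fin h)) : Perm (Fin h) := π⁻¹ * (finRotate h)⁻¹

theorem turn_turnBack {h : ℕ} (π : Perm (Fin h)) : turn (turnBack π) = π := by
  simp [turn, turnBack]

theorem turn_iterate_turnBack_iterate {h : ℕ} (i : ℕ) (π : Perm (Fin h)) :
    turn^[i] (turnBack^[i] π) = π :=
  Function.LeftInverse.iterate (f := turnBack) (g := turn) turn_turnBack i π

/-- A shift by one exchanges even and odd points, hence the inverse in `turn`. Labels are named by
even points, so they get renamed by `π⁻¹`; only equality of labels matters, and the renaming is
injective. -/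
theorem label_turn {h : ℕ} (π : Perm (Fin h)) {j : ℕ} (hj : j < 2 * h) :
    label π ((j + 1) % (2 * h)) = extend π⁻¹ (label (turn π) j) := by
  obtain _ | h := h
  · omega
  rcases Nat.even_or_odd' j with ⟨a, rfl | rfl⟩
  · rw [Nat.mod_eq_of_lt (by omega)]
    have h1 : (2 * a + 1) % 2 = 1 := by omega
    have h2 : (2 * a + 1) / 2 = a := by omega
    simp [label, h1, h2]
  · have h1 : (2 * a + 1) % 2 = 1 := by omega
    have h2 : (2 * a + 1) / 2 = a := by omega
    have h3 : (2 * a + 1 + 1) % (2 * (h + 1)) = 2 * ((a + 1) % (h + 1)) := by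
      rw [show 2 * a + 1 + 1 = 2 * (a + 1) by ring, Nat.mul_mod_mul_left]
    have ha : a < h + 1 := by omega
    have h4 : ((finRotate (h + 1)) ⟨a, ha⟩).val = (a + 1) % (h + 1) := by
      rw [finRotate_apply, Fin.val_add]
      simp
    have h5 : (turn π)⁻¹ ⟨a, ha⟩ = π (finRotate (h + 1) ⟨a, ha⟩) := by
      simp [turn]
    rw [h3]
    simp only [label, h1, h2, extend_of_lt _ ha, h5, one_ne_zero, if_false, extend_inv_apply, h4]
    simp

theorem label_turn_iterate {h : ℕ} (i : ℕ) (π : Perm (Fin h)) {j k : ℕ} (hj : j < 2 * h)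
    (hk : k < 2 * h) : label (turn^[i] π) j = label (turn^[i] π) k ↔
      label π ((j + i) % (2 * h)) = label π ((k + i) % (2 * h)) := by
  induction i generalizing π with
  | zero => simp [Nat.mod_eq_of_lt hj, Nat.mod_eq_of_lt hk]
  | succ i ih =>
    rw [Function.iterate_succ_apply, ih, ← (extend_injective π⁻¹).eq_iff,
      ← label_turn π (Nat.mod_lt _ (by omega)), ← label_turn π (Nat.mod_lt _ (by omega))]
    simp only [Nat.mod_add_mod, add_assoc]

/-! ### Joining adjacent points and inserting arcs -/

/-- The points on the larger circle of a cup or cap at `i` that continue the points of the smaller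
one. -/
def skip (i x : ℕ) : ℕ := if x < i then x else x + 2

/-- `x` and `y` lie on the same arc after the arcs at `a` and `b` have been joined. -/
def JoinedBy {Y : Type*} (L : ℕ → Y) (a b x y : ℕ) : Prop :=
  L x = L y ∨ ((L x = L a ∨ L x = L b) ∧ (L y = L a ∨ L y = L b))

/-- The matching obtained by joining the points `0` and `1`. -/
def joinZero {h : ℕ} (π : Perm (Fin (h + 1))) : Perm (Fin h) := (Perm.decomposeFin π).2

/-- The matching obtained by joining the points `i` and `i + 1`. -/
def join {h : ℕ} (i : ℕ) (π : Perm (Fin (h + 1))) : Perm (Fin h) :=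
  turnBack^[i] (joinZero (turn^[i] π))

/-- The number of circles that are closed by joining the points `i` and `i + 1`. -/
def closed {h : ℕ} (i : ℕ) (π : Perm (Fin (h + 1))) : ℕ :=
  if (turn^[i] π) 0 = 0 then 1 else 0

/-- The matching obtained by inserting an arc between new points `i` and `i + 1`. -/
def insertArc {h : ℕ} (i : ℕ) (π : Perm (Fin h)) : Perm (Fin (h + 1)) :=
  turnBack^[i] (Perm.decomposeFin.symm (0, turn^[i] π))

theorem label_zero {h : ℕ} (π : Perm (Fin h)) : label π 0 = 0 := by simp [label]

theorem label_one {h : ℕ} (π : Perm (Fin (h + 1))) : label π 1 = (π⁻¹ 0 : Fin (h + 1)) := by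
  simp [label, extend]

/-- `Perm.decomposeFin` factors `π` as `swap 0 p` times a lift of `σ`. This is the surgery itself:
in `σ` the even point that `π` matched with point `1` inherits the partner of point `0`. The `+ 1`
accounts for the two deleted points. -/
theorem label_joinZero {h : ℕ} (π : Perm (Fin (h + 1))) {j : ℕ} (hj : j < 2 * h) :
    label (joinZero π) j + 1 =
      if label π (j + 2) = 0 then label π 1 else label π (j + 2) := by
  obtain ⟨⟨p, σ⟩, rfl⟩ := Perm.decomposeFin.symm.surjective π
  have hσ : joinZero (Perm.decomposeFin.symm (p, σ)) = σ := by simp [joinZero]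
  rw [hσ]
  rcases Nat.even_or_odd' j with ⟨a, rfl | rfl⟩
  · have : (2 * a + 2) / 2 = a + 1 := by omega
    simp [label, this]
  · have h1 : (2 * a + 1) % 2 = 1 := by omega
    have h2 : (2 * a + 1) / 2 = a := by omega
    have h3 : (2 * a + 1 + 2) % 2 = 1 := by omega
    have h4 : (2 * a + 1 + 2) / 2 = a + 1 := by omega
    have ha : a < h := by omega
    obtain ⟨b, hb⟩ := σ.surjective ⟨a, ha⟩
    have hb' : σ⁻¹ ⟨a, ha⟩ = b := by rw [← hb]; simp
    rw [label_one]
    simp only [label, h1, h2, h3, h4, extend_of_lt _ ha, hb', extend_of_lt _ (Nat.succ_lt_succ ha)]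
    by_cases hp : p = (⟨a, ha⟩ : Fin h).succ
    · have e1 : (Perm.decomposeFin.symm (p, σ))⁻¹ ⟨a + 1, Nat.succ_lt_succ ha⟩ = 0 := by
        rw [Perm.inv_eq_iff_eq, Perm.decomposeFin_symm_apply_zero, hp]; rfl
      have e2 : (Perm.decomposeFin.symm (p, σ))⁻¹ 0 = b.succ := by
        rw [Perm.inv_eq_iff_eq, Perm.decomposeFin_symm_apply_succ, hb, hp]; simp
      simp [e1, e2]
    · have e1 : (Perm.decomposeFin.symm (p, σ))⁻¹ ⟨a + 1, Nat.succ_lt_succ ha⟩ = b.succ := by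
        rw [Perm.inv_eq_iff_eq, Perm.decomposeFin_symm_apply_succ, hb,
          swap_apply_of_ne_of_ne (Fin.succ_ne_zero _) (Ne.symm hp)]; rfl
      simp [e1]

theorem label_decomposeFin_symm_zero {h : ℕ} (π : Perm (Fin h)) {j : ℕ} (hj : j < 2 * h) :
    label (Perm.decomposeFin.symm (0, π)) (j + 2) = label π j + 1 := by
  have h1 := label_joinZero (Perm.decomposeFin.symm (0, π)) hj
  have h2 : joinZero (Perm.decomposeFin.symm (0, π)) = π := by simp [joinZero]
  have h3 : label (Perm.decomposeFin.symm (0, π)) 1 = 0 := by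
    rw [label_one, show (Perm.decomposeFin.symm (0, π))⁻¹ (0 : Fin (h + 1)) = 0 by
      rw [Perm.inv_eq_iff_eq, Perm.decomposeFin_symm_apply_zero]]
    rfl
  rw [h2, h3] at h1
  split_ifs at h1 with h4
  exact h1.symm

theorem joinedBy_joinZero {h : ℕ} (π : Perm (Fin (h + 1))) {j k : ℕ} (hj : j < 2 * h)
    (hk : k < 2 * h) : label (joinZero π) j = label (joinZero π) k ↔
      JoinedBy (label π) 0 1 (j + 2) (k + 2) := by
  rw [← Nat.succ_inj, Nat.succ_eq_add_one, Nat.succ_eq_add_one, label_joinZero π hj,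
    label_joinZero π hk, JoinedBy, label_zero]
  grind

theorem exists_unrotate {m i x : ℕ} (hx : x < m) : ∃ y < m, (y + i) % m = x := by
  refine ⟨(x + (m - i % m)) % m, Nat.mod_lt _ (by omega), ?_⟩
  have h1 : i % m < m := Nat.mod_lt _ (by omega)
  conv_lhs => rw [Nat.mod_add_mod, ← Nat.add_mod_mod]
  rw [show x + (m - i % m) + i % m = x + m by omega, Nat.add_mod_right, Nat.mod_eq_of_lt hx]

theorem skip_rotate {h i y : ℕ} (hi : i ≤ 2 * h) (hy : y < 2 * h) :
    skip i ((y + i) % (2 * h)) = (y + 2 + i) % (2 * (h + 1)) := by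
  unfold skip
  rcases lt_or_ge (y + i) (2 * h) with h1 | h1
  · rw [Nat.mod_eq_of_lt h1, Nat.mod_eq_of_lt (by omega), if_neg (by omega)]
    omega
  · rw [Nat.mod_eq_sub_mod h1, Nat.mod_eq_of_lt (by omega), Nat.mod_eq_sub_mod (by omega),
      Nat.mod_eq_of_lt (by omega), if_pos (by omega)]
    omega

theorem label_turnBack_iterate {h : ℕ} (i : ℕ) (π : Perm (Fin h)) {j k : ℕ} (hj : j < 2 * h)
    (hk : k < 2 * h) :
    label (turnBack^[i] π) ((j + i) % (2 * h)) = label (turnBack^[i] π) ((k + i) % (2 * h)) ↔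
      label π j = label π k := by
  rw [← label_turn_iterate i _ hj hk, turn_iterate_turnBack_iterate]

/-- Rotating by `i` reduces this to joining `0` and `1`; `skip_rotate` matches the indices,
including wrap-around. -/
theorem label_join {h i x y : ℕ} (π : Perm (Fin (h + 1))) (hi : i ≤ 2 * h) (hx : x < 2 * h)
    (hy : y < 2 * h) : label (join i π) x = label (join i π) y ↔
      JoinedBy (label π) i (i + 1) (skip i x) (skip i y) := by
  obtain ⟨j, hj, rfl⟩ := exists_unrotate (i := i) hx
  obtain ⟨k, hk, rfl⟩ := exists_unrotate (i := i) hy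
  have h0 : i = (0 + i) % (2 * (h + 1)) := by rw [Nat.mod_eq_of_lt (by omega)]; omega
  have h1 : i + 1 = (1 + i) % (2 * (h + 1)) := by rw [Nat.mod_eq_of_lt (by omega)]; omega
  have key (a b : ℕ) (ha : a < 2 * (h + 1)) (hb : b < 2 * (h + 1)) :=
    label_turn_iterate i π ha hb
  rw [join, label_turnBack_iterate i _ hj hk, joinedBy_joinZero _ hj hk, skip_rotate hi hj,
    skip_rotate hi hk, JoinedBy, JoinedBy, key _ _ (by omega) (by omega),
    key _ _ (by omega) (by omega), key _ _ (by omega) (by omega), key _ _ (by omega) (by omega),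
    key _ _ (by omega) (by omega), ← h0, ← h1]

theorem closed_eq {h i : ℕ} (π : Perm (Fin (h + 1))) (hi : i ≤ 2 * h) :
    closed i π = if label π i = label π (i + 1) then 1 else 0 := by
  have h0 : i = (0 + i) % (2 * (h + 1)) := by rw [Nat.mod_eq_of_lt (by omega)]; omega
  have h1 : i + 1 = (1 + i) % (2 * (h + 1)) := by rw [Nat.mod_eq_of_lt (by omega)]; omega
  have key := label_turn_iterate i π (j := 0) (k := 1) (by omega) (by omega)
  rw [← h0, ← h1, label_zero, label_one] at key
  unfold closed
  refine if_congr ?_ rfl rfl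
  rw [← key, eq_comm, eq_comm (a := (0 : ℕ)), Fin.val_eq_zero_iff, Perm.inv_eq_iff_eq]

theorem label_insertArc_left {h i : ℕ} (π : Perm (Fin h)) (hi : i ≤ 2 * h) :
    label (insertArc i π) i = label (insertArc i π) (i + 1) := by
  have h0 : i = (0 + i) % (2 * (h + 1)) := by rw [Nat.mod_eq_of_lt (by omega)]; omega
  have h1 : i + 1 = (1 + i) % (2 * (h + 1)) := by rw [Nat.mod_eq_of_lt (by omega)]; omega
  have key := label_turnBack_iterate i (Perm.decomposeFin.symm (0, turn^[i] π))
    (j := 0) (k := 1) (by omega) (by omega)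
  rw [← h0, ← h1] at key
  refine key.2 ?_
  rw [label_zero, label_one, eq_comm, Fin.val_eq_zero_iff, Perm.inv_eq_iff_eq,
    Perm.decomposeFin_symm_apply_zero]

theorem label_insertArc_skip_ne {h i x : ℕ} (π : Perm (Fin h)) (hi : i ≤ 2 * h) (hx : x < 2 * h) :
    label (insertArc i π) (skip i x) ≠ label (insertArc i π) i := by
  obtain ⟨j, hj, rfl⟩ := exists_unrotate (i := i) hx
  have h0 : i = (0 + i) % (2 * (h + 1)) := by rw [Nat.mod_eq_of_lt (by omega)]; omega
  have key := label_turnBack_iterate i (Perm.decomposeFin.symm (0, turn^[i] π))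
    (j := j + 2) (k := 0) (by omega) (by omega)
  rw [← h0, ← skip_rotate hi hj, label_decomposeFin_symm_zero _ hj, label_zero] at key
  exact fun h => absurd (key.1 h) (by omega)

theorem label_insertArc_skip {h i x y : ℕ} (π : Perm (Fin h)) (hi : i ≤ 2 * h) (hx : x < 2 * h)
    (hy : y < 2 * h) : label (insertArc i π) (skip i x) = label (insertArc i π) (skip i y) ↔
      label π x = label π y := by
  obtain ⟨j, hj, rfl⟩ := exists_unrotate (i := i) hx
  obtain ⟨k, hk, rfl⟩ := exists_unrotate (i := i) hy
  rw [skip_rotate hi hj, skip_rotate hi hk, insertArc,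
    label_turnBack_iterate i _ (by omega) (by omega), label_decomposeFin_symm_zero _ hj,
    label_decomposeFin_symm_zero _ hk, Nat.add_right_cancel_iff, label_turn_iterate i _ hj hk]

/-! ### Signs of matchings -/

theorem sign_turn_iterate {h : ℕ} (i : ℕ) (π : Perm (Fin h)) :
    Perm.sign (turn^[i] π) = Perm.sign (finRotate h) ^ i * Perm.sign π := by
  induction i with
  | zero => simp
  | succ i ih =>
    rw [Function.iterate_succ_apply', turn, map_mul, map_inv, map_inv, ih, pow_succ]
    simp [mul_assoc, mul_comm]

theorem sign_turnBack_iterate {h : ℕ} (i : ℕ) (π : Perm (Fin h)) :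
    Perm.sign (turnBack^[i] π) = Perm.sign (finRotate h) ^ i * Perm.sign π := by
  induction i with
  | zero => simp
  | succ i ih =>
    rw [Function.iterate_succ_apply', turnBack, map_mul, map_inv, map_inv, ih, pow_succ]
    simp [mul_assoc, mul_comm]

/-- Dropping `swap 0 p` flips the sign exactly when `p ≠ 0`, that is, when no circle is closed. The
factor for a closed circle makes the total change independent of `π`. -/
theorem sign_join {h : ℕ} (i : ℕ) (π : Perm (Fin (h + 1))) :
    Perm.sign (join i π) * (-1) ^ closed i π =
      -(Perm.sign (finRotate h) ^ i * Perm.sign (finRotate (h + 1)) ^ i) * Perm.sign π := by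
  have key (ρ : Perm (Fin (h + 1))) : Perm.sign (joinZero ρ) * (-1) ^ (if ρ 0 = 0 then 1 else 0) =
      -Perm.sign ρ := by
    obtain ⟨⟨p, σ⟩, rfl⟩ := Perm.decomposeFin.symm.surjective ρ
    rw [Perm.decomposeFin_symm_apply_zero, Perm.decomposeFin.symm_sign]
    have hσ : joinZero (Perm.decomposeFin.symm (p, σ)) = σ := by simp [joinZero]
    rw [hσ]
    split_ifs <;> simp
  rw [join, sign_turnBack_iterate, mul_assoc, closed, key, sign_turn_iterate]
  simp [mul_assoc]

theorem sign_insertArc {h : ℕ} (i : ℕ) (π : Perm (Fin h)) :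
    Perm.sign (insertArc i π) =
      (Perm.sign (finRotate (h + 1)) ^ i * Perm.sign (finRotate h) ^ i) * Perm.sign π := by
  rw [insertArc, sign_turnBack_iterate, Perm.decomposeFin.symm_sign, sign_turn_iterate]
  simp [mul_assoc]

/-! ### Circles of crossingless diagrams -/

/-- The pattern in which a crossingless diagram with `n` endpoints joins them, together with the
number of its closed circles. -/
abbrev LoopState (n : ℕ) : Type := Perm (Fin (half n)) × ℕ

/-- The effect of putting a slice inside a crossingless diagram whose only endpoints are on its
inner circle.  (The value at a crossing is irrelevant.) -/
def Slice.act : {n m : ℕ} → Slice n m → LoopState m → LoopState n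
  | _, _, .cup n i, y => (join (h := half n) i y.1, y.2 + closed (h := half n) i y.1)
  | _, _, .cap n i, y => (insertArc (h := half n) i y.1, y.2)
  | _, _, .crossing _ _ _, y => y
  | _, _, .rot _, y => (turn y.1, y.2)
  | _, _, .rotInv _, y => (turnBack y.1, y.2)

/-- The slice has no crossing. -/
def Slice.Crossingless : {n m : ℕ} → Slice n m → Prop
  | _, _, .crossing _ _ _ => False
  | _, _, _ => True

namespace Diagram

/-- The effect of putting a crossingless diagram inside another one. -/
def act : {n m : ℕ} → Diagram n m → LoopState m → LoopState n
  | _, _, nil _, y => y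
  | _, _, cons s D, y => s.act (D.act y)

/-- The diagram has no crossing. -/
def Crossingless : {n m : ℕ} → Diagram n m → Prop
  | _, _, nil _ => True
  | _, _, cons s D => s.Crossingless ∧ D.Crossingless

theorem act_glue {n m k : ℕ} (D : Diagram n m) (E : Diagram m k) (y : LoopState k) :
    (glue D E).act y = D.act (E.act y) := by
  induction D with
  | nil n => rfl
  | cons s D ih => simp only [glue, act, ih]

theorem Crossingless.glue {n m k : ℕ} {D : Diagram n m} {E : Diagram m k} (hD : D.Crossingless)
    (hE : E.Crossingless) : (D.glue E).Crossingless := by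
  induction D with
  | nil n => exact hE
  | cons s D ih => exact ⟨hD.1, ih hD.2 hE⟩

theorem crossingless_resolve {n m : ℕ} (D : Diagram n m) (σ : D.State) :
    (D.resolve σ).Crossingless := by
  induction D with
  | nil n => trivial
  | cons s D ih =>
    refine Crossingless.glue ?_ (ih _)
    cases s with
    | crossing n i o =>
      dsimp only [Slice.split]
      cases o <;> cases σ (Sum.inl ()) <;> simp [Crossingless, single, Slice.Crossingless]
    | _ => exact ⟨trivial, trivial⟩

/-! ### Components of glued slices -/

theorem finite_points {n m : ℕ} (D : Diagram n m) : Finite D.Points := by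
  induction D with
  | nil n => exact inferInstanceAs (Finite (Fin n))
  | cons s D ih => exact inferInstanceAs (Finite (Fin _ ⊕ D.Points))

instance finite_quot_arc {n m : ℕ} (D : Diagram n m) : Finite (Quot D.Arc) :=
  have := D.finite_points
  inferInstance

/-- The component of an inner endpoint. -/
def comp {n m : ℕ} (D : Diagram n m) (j : Fin n) : Quot D.Arc := Quot.mk _ (D.start j)

/-- The component in `cons s D` of a component of `D`. -/
def outer {n m k : ℕ} (s : Slice n m) (D : Diagram m k) : Quot D.Arc → Quot (cons s D).Arc :=
  Quot.lift (fun x => Quot.mk _ (Sum.inr x)) fun _ _ h =>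
    Quot.sound (Or.inr ⟨_, _, h, rfl, rfl⟩)

/-- The component in `cons s D` of an endpoint of `s`. -/
def sliceComp {n m k : ℕ} (s : Slice n m) (D : Diagram m k) :
    Fin n ⊕ Fin m → Quot (cons s D).Arc :=
  Sum.elim (cons s D).comp (fun j => outer s D (D.comp j))

theorem sliceComp_eq {n m k : ℕ} {s : Slice n m} (D : Diagram m k) {a b : Fin n ⊕ Fin m}
    (h : s.Arc a b) : sliceComp s D a = sliceComp s D b := by
  have key (a : Fin n ⊕ Fin m) :
      sliceComp s D a = Quot.mk (cons s D).Arc (Sum.map id D.start a) := by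
    cases a <;> rfl
  rw [key, key]
  exact Quot.sound (Or.inl ⟨a, b, h, rfl, rfl⟩)

/-- The components of `cons s D` as a pushout. -/
theorem exists_equiv_quot_cons {n m k : ℕ} (s : Slice n m) (D : Diagram m k) {T : Type}
    (f : Fin n → T) (g : Quot D.Arc → T)
    (hfg : ∀ a b, s.Arc a b → Sum.elim f (fun j => g (D.comp j)) a =
      Sum.elim f (fun j => g (D.comp j)) b)
    (r : T → Quot (cons s D).Arc) (hf : ∀ j, r (f j) = (cons s D).comp j)
    (hg : ∀ y, r (g y) = outer s D y) (hsurj : ∀ t, (∃ j, f j = t) ∨ ∃ y, g y = t) :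
    ∃ e : Quot (cons s D).Arc ≃ T, ∀ j, e ((cons s D).comp j) = f j := by
  let F : (cons s D).Points → T := Sum.elim f (fun x => g (Quot.mk _ x))
  have hF : ∀ x y, (cons s D).Arc x y → F x = F y := by
    rintro x y (⟨a, b, h, rfl, rfl⟩ | ⟨x', y', h, rfl, rfl⟩)
    · have := hfg a b h
      cases a <;> cases b <;> exact this
    · exact congrArg g (Quot.sound h)
  refine ⟨Equiv.ofBijective (Quot.lift F hF) ⟨?_, ?_⟩, fun j => rfl⟩
  · refine Function.LeftInverse.injective (g := r) ?_
    rintro ⟨x | x⟩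
    · exact hf x
    · exact hg (Quot.mk _ x)
  · intro t
    rcases hsurj t with ⟨j, rfl⟩ | ⟨⟨x⟩, rfl⟩
    · exact ⟨Quot.mk _ (Sum.inl j), rfl⟩
    · exact ⟨Quot.mk _ (Sum.inr x), rfl⟩

/-- The endpoints of `D` are joined as prescribed by `y.1`, and besides `D` has `y.2` closed
circles. -/
structure Realizes {n m : ℕ} (D : Diagram n m) (y : LoopState n) : Prop where
  even : n = 2 * half n
  comp_eq_iff (j k : Fin n) : D.comp j = D.comp k ↔ label y.1 j = label y.1 k
  numCircles_eq : D.numCircles = half n + y.2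

theorem Realizes.rot {n m : ℕ} {D : Diagram n m} {y : LoopState n} (h : D.Realizes y) :
    (cons (.rot n) D).Realizes ((Slice.rot n).act y) := by
  have hpos (j : Fin n) : (j.val + 1) % n < n := Nat.mod_lt _ j.pos
  obtain ⟨e, he⟩ := exists_equiv_quot_cons (.rot n) D
    (fun j => D.comp ⟨(j.val + 1) % n, hpos j⟩) id (by
      rintro (a | a) (b | b) hab <;> simp only [Slice.Arc] at hab
      exact congrArg D.comp (Fin.ext hab.symm))
    (outer _ D) (fun j => (sliceComp_eq D (s := .rot n) (a := .inl j)
      (b := .inr ⟨(j.val + 1) % n, hpos j⟩) rfl).symm)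
    (fun y => rfl) (fun t => Or.inr ⟨t, rfl⟩)
  refine ⟨h.even, fun j k => ?_, ?_⟩
  · rw [← e.injective.eq_iff, he, he, h.comp_eq_iff]
    have := label_turn_iterate 1 y.1 (j.isLt.trans_eq h.even) (k.isLt.trans_eq h.even)
    rw [← h.even] at this
    exact this.symm
  · exact (Nat.card_congr e).trans h.numCircles_eq

theorem Realizes.rotInv {n m : ℕ} {D : Diagram n m} {y : LoopState n} (h : D.Realizes y) :
    (cons (.rotInv n) D).Realizes ((Slice.rotInv n).act y) := by
  have hpos (j : Fin n) : (j.val + (n - 1)) % n < n := Nat.mod_lt _ j.pos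
  have hback (j : ℕ) (hj : j < n) : ((j + (n - 1)) % n + 1) % n = j := by
    rw [Nat.mod_add_mod, show j + (n - 1) + 1 = j + n by omega, Nat.add_mod_right,
      Nat.mod_eq_of_lt hj]
  have hback' (j : ℕ) (hj : j < n) : ((j + 1) % n + (n - 1)) % n = j := by
    rw [Nat.mod_add_mod, show j + 1 + (n - 1) = j + n by omega, Nat.add_mod_right,
      Nat.mod_eq_of_lt hj]
  obtain ⟨e, he⟩ := exists_equiv_quot_cons (.rotInv n) D
    (fun j => D.comp ⟨(j.val + (n - 1)) % n, hpos j⟩) id (by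
      rintro (a | a) (b | b) hab <;> simp only [Slice.Arc] at hab
      refine congrArg D.comp (Fin.ext ?_)
      simp only [hab, hback' b b.isLt])
    (outer _ D) (fun j => (sliceComp_eq D (s := .rotInv n) (a := .inl j)
      (b := .inr ⟨(j.val + (n - 1)) % n, hpos j⟩) (hback j j.isLt).symm).symm)
    (fun y => rfl) (fun t => Or.inr ⟨t, rfl⟩)
  refine ⟨h.even, fun j k => ?_, ?_⟩
  · rw [← e.injective.eq_iff, he, he, h.comp_eq_iff]
    have := label_turnBack_iterate 1 y.1 (j := (j.val + (n - 1)) % n) (k := (k.val + (n - 1)) % n)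
      ((hpos j).trans_eq h.even) ((hpos k).trans_eq h.even)
    rw [← h.even, hback j j.isLt, hback k k.isLt] at this
    exact this.symm
  · exact (Nat.card_congr e).trans h.numCircles_eq

/-- A cap adds one component, containing the inner points `i` and `i + 1`; this is the `none` of an
`Option` type. -/
theorem Realizes.cap {n m : ℕ} {D : Diagram n m} {y : LoopState n} (h : D.Realizes y)
    (i : Fin (n + 1)) : (cons (.cap n i) D).Realizes ((Slice.cap n i).act y) := by
  classical
  have hi : i.val ≤ 2 * half n := by have := i.isLt; have := h.even; omega
  have hlt (j : Fin (n + 2)) (hj : ¬ (j.val = i ∨ j.val = i + 1)) :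
      (if j.val < i then j.val else j.val - 2) < n := by
    have := j.isLt; have := i.isLt; split_ifs <;> omega
  obtain ⟨e, he⟩ := exists_equiv_quot_cons (.cap n i) D
    (fun j => if hj : j.val = i ∨ j.val = i + 1 then none else
      some (D.comp ⟨if j.val < i then j.val else j.val - 2, hlt j hj⟩)) some (by
      rintro (a | a) (b | b) hab <;> simp only [Slice.Arc] at hab
      · simp [hab]
      · have h1 : ¬ (a.val = i ∨ a.val = i + 1) := by split_ifs at hab <;> omega
        simp only [Sum.elim_inl, Sum.elim_inr, h1, dite_false]
        refine congrArg (fun j => some (D.comp j)) (Fin.ext ?_)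
        simp only
        split_ifs at hab ⊢ <;> omega)
    (fun t => t.elim ((cons (.cap n i) D).comp ⟨i, by omega⟩) (outer _ D)) (by
      intro j
      by_cases hj : j.val = i ∨ j.val = i + 1
      · simp only [hj, dite_true, Option.elim_none]
        rcases hj with hj | hj
        · exact congrArg _ (Fin.ext hj.symm)
        · exact sliceComp_eq D (s := .cap n i) (a := .inl _) (b := .inl j) ⟨rfl, hj⟩
      · simp only [hj, dite_false, Option.elim_some]
        refine (sliceComp_eq D (s := .cap n i) (a := .inl j) (b := .inr _) ?_).symm
        simp only [Slice.Arc]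
        split_ifs <;> omega)
    (fun y => rfl) (by
      rintro (_ | t)
      · exact Or.inl ⟨⟨i, by omega⟩, by simp⟩
      · exact Or.inr ⟨t, rfl⟩)
  have heven : n + 2 = 2 * half (n + 2) := by
    have := h.even
    simp only [half]
    omega
  refine ⟨heven, fun j k => ?_, ?_⟩
  · have hskip (j : Fin (n + 2)) (hj : ¬ (j.val = i ∨ j.val = i + 1)) :
        j.val = skip i (if j.val < i then j.val else j.val - 2) := by
      unfold skip; split_ifs <;> omega
    have hlab (j : Fin (n + 2)) (hj : j.val = i ∨ j.val = i + 1) :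
        label (insertArc (h := half n) i y.1) j = label (insertArc (h := half n) i y.1) i := by
      rcases hj with hj | hj
      · rw [hj]
      · rw [hj, ← label_insertArc_left y.1 hi]
    rw [← e.injective.eq_iff, he, he]
    change _ ↔ label (insertArc (h := half n) i y.1) j = label (insertArc (h := half n) i y.1) k
    by_cases hj : j.val = i ∨ j.val = i + 1 <;> by_cases hk : k.val = i ∨ k.val = i + 1
    · simp [hj, hk, hlab]
    · have := label_insertArc_skip_ne y.1 hi ((hlt k hk).trans_eq h.even)
      rw [← hskip k hk, ← hlab j hj] at this
      simp [hj, hk, this.symm]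
    · have := label_insertArc_skip_ne y.1 hi ((hlt j hj).trans_eq h.even)
      rw [← hskip j hj, ← hlab k hk] at this
      simp [hj, hk, this]
    · have := label_insertArc_skip y.1 hi ((hlt j hj).trans_eq h.even) ((hlt k hk).trans_eq h.even)
      rw [← hskip j hj, ← hskip k hk] at this
      simp only [hj, hk, dite_false, Option.some.injEq, h.comp_eq_iff, this]
  · have := h.numCircles_eq
    unfold numCircles at this ⊢
    rw [Nat.card_congr e, Finite.card_option, this]
    simp only [half, Slice.act]
    omega

/-- A cup merges the components `a` and `b` of its two outer points. The number of components drops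
by one, unless `a = b`, when a circle closes. -/
theorem Realizes.cup {n m : ℕ} {D : Diagram (n + 2) m} {y : LoopState (n + 2)} (h : D.Realizes y)
    (i : Fin (n + 1)) : (cons (.cup n i) D).Realizes ((Slice.cup n i).act y) := by
  classical
  have heven : n = 2 * half n := by
    have := h.even
    simp only [half] at this
    omega
  have hi : i.val ≤ 2 * half n := by have := i.isLt; omega
  have hlt (j : Fin n) : skip i j < n + 2 := by have := j.isLt; unfold skip; split_ifs <;> omega
  set a := D.comp ⟨i, by omega⟩ with ha
  set b := D.comp ⟨i + 1, by omega⟩ with hb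
  -- The merged component is represented by `b`, so `a` is removed, except when it is `b` itself.
  let T := {y : Quot D.Arc // y ≠ a ∨ a = b}
  let g : Quot D.Arc → T := fun y => if hy : y = a then ⟨b, by tauto⟩ else ⟨y, Or.inl hy⟩
  have hab : outer (.cup n i) D a = outer (.cup n i) D b :=
    sliceComp_eq D (s := .cup n i) (a := .inr _) (b := .inr _) ⟨rfl, rfl⟩
  have hg (y) : outer (.cup n i) D (g y).1 = outer (.cup n i) D y := by
    by_cases hy : y = a
    · simp [g, hy, hab]
    · simp [g, hy]
  obtain ⟨e, he⟩ := exists_equiv_quot_cons (.cup n i) D (fun j => g (D.comp ⟨skip i j, hlt j⟩)) g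
    (by
      rintro (j | j) (k | k) hjk <;> simp only [Slice.Arc] at hjk
      · exact congrArg (fun l => g (D.comp l)) (Fin.ext hjk.symm)
      · have hj : D.comp j = a := congrArg D.comp (Fin.ext hjk.1)
        have hk : D.comp k = b := congrArg D.comp (Fin.ext hjk.2)
        simp only [Sum.elim_inr, hj, hk, g]
        by_cases hba : b = a <;> simp [hba])
    (fun t => outer _ D t.1)
    (fun j => (hg _).trans (sliceComp_eq D (s := .cup n i) (a := .inl j)
      (b := .inr ⟨skip i j, hlt j⟩) rfl).symm)
    hg (by
      rintro ⟨t, ht⟩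
      refine Or.inr ⟨t, ?_⟩
      by_cases hta : t = a
      · subst hta
        have hb' : b = a := by simpa [eq_comm] using ht
        exact Subtype.ext (by simp [g, hb'])
      · simp [g, hta])
  refine ⟨heven, fun j k => ?_, ?_⟩
  · rw [← e.injective.eq_iff, he, he]
    refine Iff.trans ?_ (label_join y.1 hi (j.isLt.trans_eq heven) (k.isLt.trans_eq heven)).symm
    have key := h.comp_eq_iff
    have k1 := key ⟨skip i j, hlt j⟩ ⟨skip i k, hlt k⟩
    have k2 := key ⟨skip i j, hlt j⟩ ⟨i, by omega⟩
    have k3 := key ⟨skip i j, hlt j⟩ ⟨i + 1, by omega⟩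
    have k4 := key ⟨skip i k, hlt k⟩ ⟨i, by omega⟩
    have k5 := key ⟨skip i k, hlt k⟩ ⟨i + 1, by omega⟩
    rw [← ha] at k2 k4
    rw [← hb] at k3 k5
    rw [JoinedBy]
    refine Iff.trans ?_ (or_congr k1 (and_congr (or_congr k2 k3) (or_congr k4 k5)))
    generalize D.comp ⟨skip i j, hlt j⟩ = u
    generalize D.comp ⟨skip i k, hlt k⟩ = v
    by_cases hu : u = a <;> by_cases hv : v = a <;> simp [g, hu, hv] <;> grind
  · have hcard := h.numCircles_eq
    have hcl : closed (h := half n) i y.1 = if a = b then 1 else 0 := by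
      refine (closed_eq (h := half n) y.1 hi).trans ?_
      exact if_congr (h.comp_eq_iff ⟨i, by omega⟩ ⟨i + 1, by omega⟩).symm rfl rfl
    unfold numCircles at hcard ⊢
    rw [Nat.card_congr e]
    simp only [half, Slice.act, hcl] at hcard ⊢
    by_cases hba : a = b
    · have : Nat.card T = Nat.card (Quot D.Arc) :=
        Nat.card_congr (Equiv.subtypeUnivEquiv fun _ => Or.inr hba)
      rw [this, hcard, if_pos hba]
      omega
    · have h1 : Nat.card T = Nat.card {y // y ≠ a} :=
        Nat.card_congr (Equiv.subtypeEquivRight fun _ => by simp [hba])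
      have h2 := Nat.card_congr (Equiv.optionSubtypeNe a)
      rw [Finite.card_option] at h2
      rw [h1, if_neg hba]
      omega

theorem realizes_nil : (nil 0).Realizes (1, 0) :=
  ⟨rfl, fun j => j.elim0, 
    have : IsEmpty (Quot (nil 0).Arc) := ⟨Quot.ind fun x : Fin 0 => x.elim0⟩
    Nat.card_of_isEmpty⟩

/-- Slices are added from the outside inwards, starting at the empty diagram; the equation for `m`
keeps the index general for the induction. -/
theorem Realizes.act {n m : ℕ} {D : Diagram n m} (hD : D.Crossingless) (hm : m = 0) :
    D.Realizes (D.act (hm ▸ (1, 0))) := by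
  induction D with
  | nil n => subst hm; exact realizes_nil
  | cons s D ih =>
    have := ih hD.2 hm
    cases s with
    | cup n i => exact this.cup i
    | cap n i => exact this.cap i
    | rot n => exact this.rot
    | rotInv n => exact this.rotInv
    | crossing n i o => exact hD.1.elim

theorem numCircles_eq_act {L : LinkDiagram} (hL : L.Crossingless) :
    L.numCircles = (L.act (1, 0)).2 :=
  (Realizes.act hL rfl).numCircles_eq.trans (Nat.zero_add _)

end Diagram
/-! ### State sums -/

/-- The factor of a splitting in the Kauffman bracket. -/
noncomputable def Splitting.weight (A : ℂ) (τ : Splitting) : ℂ := if τ = .A then A else A⁻¹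

/-- The sum of `g` over all states of a slice put inside a crossingless diagram of type `y`. -/
noncomputable def Slice.stateSum (A : ℂ) {n m : ℕ} (s : Slice n m) (g : LoopState n → ℂ)
    (y : LoopState m) : ℂ :=
  ∑ τ : s.Crossings → Splitting, (∏ c, (τ c).weight A) * g ((s.split τ).act y)

/-- The sum of `g` over all states of a diagram put inside a crossingless diagram of type `y`. -/
noncomputable def Diagram.stateSum (A : ℂ) {n m : ℕ} (D : Diagram n m) (g : LoopState n → ℂ)
    (y : LoopState m) : ℂ :=
  ∑ σ : D.State, (∏ c, (σ c).weight A) * g ((D.resolve σ).act y)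

theorem Splitting.prod_weight (A : ℂ) {X : Type*} [Fintype X] (σ : X → Splitting) :
    ∏ c, (σ c).weight A = A ^ Fintype.card {c // σ c = .A} * A⁻¹ ^ Fintype.card {c // σ c = .B} := by
  have h : ∀ c, σ c = .B ↔ ¬ σ c = .A := fun c => by cases σ c <;> simp
  simp only [h, Splitting.weight, Finset.prod_ite, Finset.prod_const, Fintype.card_subtype]

theorem Splitting.sum_eq (f : Splitting → ℂ) : ∑ τ, f τ = f .A + f .B := by
  rw [show (Finset.univ : Finset Splitting) = {.A, .B} from rfl, Finset.sum_pair (by simp)]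

theorem Slice.Crossingless.isEmpty_crossings {n m : ℕ} {s : Slice n m} (hs : s.Crossingless) :
    IsEmpty s.Crossings := by
  cases s with
  | crossing n i o => exact hs.elim
  | _ => exact inferInstanceAs (IsEmpty Empty)

theorem Slice.act_split {n m : ℕ} {s : Slice n m} (hs : s.Crossingless)
    (τ : s.Crossings → Splitting) (y : LoopState m) : (s.split τ).act y = s.act y := by
  cases s with
  | crossing n i o => exact hs.elim
  | _ => rfl

theorem Slice.stateSum_of_crossingless (A : ℂ) {n m : ℕ} {s : Slice n m} (hs : s.Crossingless)
    (g : LoopState n → ℂ) (y : LoopState m) : s.stateSum A g y = g (s.act y) := by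
  have := hs.isEmpty_crossings
  rw [stateSum, Fintype.sum_subsingleton _ this.elim, Fintype.prod_empty, one_mul, act_split hs]

namespace Diagram

theorem stateSum_nil (A : ℂ) (n : ℕ) (g : LoopState n → ℂ) : (nil n).stateSum A g = g := by
  funext y
  have h1 : Subsingleton (nil n).State := inferInstanceAs (Subsingleton (Empty → Splitting))
  have h2 : IsEmpty (nil n).Crossings := inferInstanceAs (IsEmpty Empty)
  rw [stateSum, Fintype.sum_subsingleton _ (fun c => h2.elim c)]
  simp [resolve, act]

/-- A state is a pair of states, weights multiply and actions compose. The inner slice acts on `g`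
first. -/
theorem stateSum_cons (A : ℂ) {n m k : ℕ} (s : Slice n m) (D : Diagram m k)
    (g : LoopState n → ℂ) : (cons s D).stateSum A g = D.stateSum A (s.stateSum A g) := by
  funext y
  simp only [stateSum, Slice.stateSum, Finset.mul_sum]
  rw [Finset.sum_comm, ← Fintype.sum_prod_type']
  refine Fintype.sum_equiv (Equiv.sumArrowEquivProdArrow s.Crossings D.Crossings Splitting)
    (ι := (cons s D).State) _ _ fun σ => ?_
  have hprod : ∏ c, (σ c).weight A =
      (∏ c, (σ (Sum.inl c)).weight A) * ∏ c, (σ (Sum.inr c)).weight A :=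
    Fintype.prod_sum_type (fun c : s.Crossings ⊕ D.Crossings => (σ c).weight A)
  rw [hprod, resolve, act_glue, mul_comm (∏ c, _), mul_assoc]
  rfl

theorem stateSum_glue (A : ℂ) {n m k : ℕ} (D : Diagram n m) (E : Diagram m k)
    (g : LoopState n → ℂ) : (glue D E).stateSum A g = E.stateSum A (D.stateSum A g) := by
  induction D with
  | nil n => rw [stateSum_nil, glue]
  | cons s D ih => rw [glue, stateSum_cons, ih, stateSum_cons]

theorem stateSum_sum_mul (A : ℂ) {n m : ℕ} (D : Diagram n m) {ι : Type*} [Fintype ι] (a : ι → ℂ)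
    (g : ι → LoopState n → ℂ) (y : LoopState m) :
    D.stateSum A (fun x => ∑ t, a t * g t x) y = ∑ t, a t * D.stateSum A (g t) y := by
  simp only [stateSum, Finset.mul_sum]
  rw [Finset.sum_comm]
  exact Finset.sum_congr rfl fun _ _ => Finset.sum_congr rfl fun _ _ => mul_left_comm _ _ _

theorem stateSum_of_crossingless (A : ℂ) {n m : ℕ} {D : Diagram n m} (hD : D.Crossingless)
    (g : LoopState n → ℂ) (y : LoopState m) : D.stateSum A g y = g (D.act y) := by
  induction D with
  | nil n => rw [stateSum_nil, act]
  | cons s D ih =>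
    rw [stateSum_cons, ih hD.2, act, Slice.stateSum_of_crossingless A hD.1]

/-- Closed circles are never lost, so a function supported on circle-free states stays so under
state sums. -/
theorem le_act_snd {n m : ℕ} (D : Diagram n m) (y : LoopState m) : y.2 ≤ (D.act y).2 := by
  induction D with
  | nil n => exact le_rfl
  | cons s D ih =>
    refine (ih y).trans ?_
    cases s <;> simp [act, Slice.act]

theorem kauffmanBracket_eq_stateSum (A : ℂ) (L : LinkDiagram) :
    kauffmanBracket A L = L.stateSum A (fun y => (-A ^ 2 - A⁻¹ ^ 2) ^ (y.2 - 1)) (1, 0) := by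
  refine Finset.sum_congr rfl fun σ _ => ?_
  rw [numCircles_eq_act (L.crossingless_resolve σ), Splitting.prod_weight]

end Diagram

theorem Slice.stateSum_crossing (A : ℂ) (n : ℕ) (i : Fin (n + 1)) (o : OverStrand)
    (g : LoopState (n + 2) → ℂ) (y : LoopState (n + 2)) :
    (Slice.crossing n i o).stateSum A g y =
      A * g (((Slice.crossing n i o).split fun _ => .A).act y) +
      A⁻¹ * g (((Slice.crossing n i o).split fun _ => .B).act y) := by
  have hs : Subsingleton (Slice.crossing n i o).Crossings := inferInstanceAs (Subsingleton Unit)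
  let e : ((Slice.crossing n i o).Crossings → Splitting) ≃ Splitting :=
    Equiv.funUnique Unit Splitting
  refine (Fintype.sum_equiv e _
    (fun τ => τ.weight A * g (((Slice.crossing n i o).split fun _ => τ).act y)) fun τ => ?_).trans
    ((Splitting.sum_eq _).trans (by simp [Splitting.weight]))
  rw [Fintype.prod_subsingleton (fun c => (τ c).weight A) (() : Unit)]
  rfl

/-! ### Phases -/

/-- The sign that changes whenever a crossing is split the other way. -/
def LoopState.sign {n : ℕ} (y : LoopState n) : ℤˣ := Perm.sign y.1 * (-1) ^ y.2

theorem Slice.exists_sign_act {n m : ℕ} (s : Slice n m) :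
    ∃ u : ℤˣ, ∀ y, LoopState.sign (s.act y) = u * LoopState.sign y := by
  cases s with
  | cup n i =>
    refine ⟨-(Perm.sign (finRotate (half n)) ^ i.val * Perm.sign (finRotate (half n + 1)) ^ i.val),
      fun y => ?_⟩
    have key (π : Perm (Fin (half n + 1))) (c : ℕ) :
        Perm.sign (join i π) * (-1) ^ (c + closed i π) =
          -(Perm.sign (finRotate (half n)) ^ i.val * Perm.sign (finRotate (half n + 1)) ^ i.val) *
            (Perm.sign π * (-1) ^ c) := by
      rw [add_comm c, pow_add, ← mul_assoc, sign_join, mul_assoc]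
    exact key y.1 y.2
  | cap n i =>
    refine ⟨Perm.sign (finRotate (half m + 1)) ^ i.val * Perm.sign (finRotate (half m)) ^ i.val,
      fun y => ?_⟩
    exact (congrArg (· * _) (sign_insertArc (h := half m) i y.1)).trans (mul_assoc _ _ _)
  | crossing n i o => exact ⟨1, fun y => (one_mul _).symm⟩
  | rot n =>
    refine ⟨Perm.sign (finRotate (half n)), fun y => ?_⟩
    have := sign_turn_iterate 1 y.1
    simp only [Function.iterate_one, pow_one] at this
    simp only [LoopState.sign, Slice.act]
    rw [this, mul_assoc]
  | rotInv n =>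
    refine ⟨Perm.sign (finRotate (half n)), fun y => ?_⟩
    have := sign_turnBack_iterate 1 y.1
    simp only [Function.iterate_one, pow_one] at this
    simp only [LoopState.sign, Slice.act]
    rw [this, mul_assoc]

/-- The rotation factors of `join` and `insertArc` cancel, leaving the `-1` of `sign_join`. -/
theorem sign_act_cup_act_cap {n : ℕ} (i : Fin (n + 1)) (y : LoopState (n + 2)) :
    LoopState.sign ((Diagram.cons (.cap n i) (.single (.cup n i))).act y) =
      -LoopState.sign y := by
  have key (π : Perm (Fin (half n + 1))) (c : ℕ) :
      Perm.sign (insertArc i (join i π)) * (-1) ^ (c + closed i π) =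
        -(Perm.sign π * (-1) ^ c) := by
    rw [sign_insertArc, add_comm c, pow_add, mul_assoc, ← mul_assoc (Perm.sign (join _ _)),
      sign_join]
    generalize Perm.sign (finRotate (half n)) ^ i.val = a
    generalize Perm.sign (finRotate (half n + 1)) ^ i.val = b
    rcases Int.units_eq_one_or a with rfl | rfl <;> rcases Int.units_eq_one_or b with rfl | rfl <;>
      simp
  exact key y.1 y.2

/-! ### Propagation of phases -/

/-- A phase for a sign. -/
noncomputable def phase (u : ℤˣ) : ℂ := if u = 1 then 1 else Complex.I

theorem exists_phase_neg (u : ℤˣ) : ∃ ε : ℤ, phase (-u) = Complex.I * phase u * ε := by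
  rcases Int.units_eq_one_or u with rfl | rfl
  · exact ⟨1, by simp [phase]⟩
  · exact ⟨-1, by simp [phase]⟩

/-- The values of `g` are integers up to the phase of the state and a common factor `ζ`. -/
def HasPhase {n : ℕ} (ζ : ℂ) (g : LoopState n → ℂ) : Prop :=
  ∀ y, ∃ a : ℤ, g y = ζ * phase (LoopState.sign y) * a

theorem HasPhase.act {n m : ℕ} (s : Slice n m) :
    ∃ η : ℂ, η ^ 8 = 1 ∧ ∀ (ζ : ℂ) (g : LoopState n → ℂ), HasPhase ζ g →
      HasPhase (η * ζ) (fun y => g (s.act y)) := by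
  obtain ⟨u, hu⟩ := s.exists_sign_act
  rcases Int.units_eq_one_or u with rfl | rfl
  · refine ⟨1, by simp, fun ζ g hg y => ?_⟩
    obtain ⟨a, ha⟩ := hg (s.act y)
    exact ⟨a, by simp only [ha, hu, one_mul]⟩
  · refine ⟨Complex.I, ?_, fun ζ g hg y => ?_⟩
    · rw [show 8 = 4 * 2 from rfl, pow_mul, Complex.I_pow_four, one_pow]
    obtain ⟨a, ha⟩ := hg (s.act y)
    obtain ⟨ε, hε⟩ := exists_phase_neg (LoopState.sign y)
    refine ⟨ε * a, ?_⟩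
    simp only [ha, hu, neg_one_mul, hε]
    push_cast
    ring

/-- At a crossing, passing to the other splitting contributes `±i` through the sign and `-i` through
`A⁻¹ = -iA`. The product is real, so both terms are integer multiples of one common phase. -/
theorem HasPhase.stateSum_slice {A : ℂ} (hA : A ^ 2 = Complex.I) {n m : ℕ} (s : Slice n m) :
    ∃ η : ℂ, η ^ 8 = 1 ∧ ∀ (ζ : ℂ) (g : LoopState n → ℂ), HasPhase ζ g →
      HasPhase (η * ζ) (s.stateSum A g) := by
  have hI : Complex.I ^ 8 = 1 := by
    rw [show 8 = 4 * 2 from rfl, pow_mul, Complex.I_pow_four, one_pow]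
  have hA8 : A ^ 8 = 1 := by
    rw [show 8 = 2 * 4 from rfl, pow_mul, hA, Complex.I_pow_four]
  have hAinv : A⁻¹ = -Complex.I * A := by
    refine inv_eq_of_mul_eq_one_right ?_
    linear_combination -Complex.I * hA - Complex.I_sq
  by_cases hs : s.Crossingless
  · obtain ⟨η, h1, h2⟩ := HasPhase.act s
    refine ⟨η, h1, fun ζ g hg y => ?_⟩
    rw [Slice.stateSum_of_crossingless A hs]
    exact h2 ζ g hg y
  · cases s with
    | crossing n i o =>
      cases o with
      | cw =>
        refine ⟨A, hA8, fun ζ g hg y => ?_⟩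
        obtain ⟨a, ha⟩ := hg y
        obtain ⟨b, hb⟩ := hg ((Diagram.cons (.cap n i) (.single (.cup n i))).act y)
        obtain ⟨ε, hε⟩ := exists_phase_neg (LoopState.sign y)
        refine ⟨a + ε * b, ?_⟩
        rw [sign_act_cup_act_cap, hε] at hb
        rw [Slice.stateSum_crossing]
        simp only [Slice.split, hb, hAinv]
        rw [Diagram.act, ha]
        push_cast
        linear_combination (-A * ζ * phase (LoopState.sign y) * ε * b) * Complex.I_sq
      | ccw =>
        -- Here the cap followed by the cup carries the weight `A`, so the common phase has an extra
        -- `i`.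
        refine ⟨A * Complex.I, by rw [mul_pow, hA8, hI, one_mul], fun ζ g hg y => ?_⟩
        obtain ⟨a, ha⟩ := hg y
        obtain ⟨b, hb⟩ := hg ((Diagram.cons (.cap n i) (.single (.cup n i))).act y)
        obtain ⟨ε, hε⟩ := exists_phase_neg (LoopState.sign y)
        refine ⟨ε * b - a, ?_⟩
        rw [sign_act_cup_act_cap, hε] at hb
        rw [Slice.stateSum_crossing]
        simp only [Slice.split, hb, hAinv]
        rw [Diagram.act, ha]
        push_cast
        ring
    | _ => exact absurd trivial hs

theorem HasPhase.stateSum {A : ℂ} (hA : A ^ 2 = Complex.I) {n m : ℕ} (D : Diagram n m) :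
    ∃ η : ℂ, η ^ 8 = 1 ∧ ∀ (ζ : ℂ) (g : LoopState n → ℂ), HasPhase ζ g →
      HasPhase (η * ζ) (D.stateSum A g) := by
  induction D with
  | nil n => exact ⟨1, one_pow 8, fun ζ g hg => by rwa [Diagram.stateSum_nil, one_mul]⟩
  | cons s D ih =>
    obtain ⟨η, h1, h2⟩ := HasPhase.stateSum_slice hA s
    obtain ⟨θ, h3, h4⟩ := ih
    refine ⟨θ * η, by rw [mul_pow, h1, h3, one_mul], fun ζ g hg => ?_⟩
    rw [Diagram.stateSum_cons, mul_assoc]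
    exact h4 _ _ (h2 ζ g hg)

/-! ### Four endpoints -/

/-- The crossingless diagrams with four endpoints and without circles. -/
def basicState (k : Fin 2) : LoopState 4 :=
  (if k = 0 then 1 else (swap 0 1 : Perm (Fin 2)), 0)

theorem act_closingArcs (k : Fin 2) : (closingArcs k).act (1, 0) = basicState k := by
  fin_cases k <;> decide

theorem basicState_injective : Function.Injective basicState := by
  decide

/-- `Perm (Fin 2)` has two elements, so the parity constraint alone excludes nonplanar matchings of
four points. -/
theorem exists_eq_basicState {y : LoopState 4} (hy : y.2 = 0) : ∃ k, y = basicState k := by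
  obtain ⟨π, c⟩ := y
  obtain rfl : c = 0 := hy
  revert π
  decide

theorem act_fundamentalTangle_snd (j : Fin 2) (y : LoopState 4) :
    ((fundamentalTangle j).act y).2 = if y.1 = (basicState j).1 then y.2 + 1 else y.2 + 2 := by
  obtain ⟨π, c⟩ := y
  have key : ∀ (j : Fin 2) (π : Perm (Fin (half 4))), ((fundamentalTangle j).act (π, 0)).2 =
    if π = (basicState j).1 then 1 else 2 := by decide
  -- Existing circles only add to the count, which leaves a finite check at `c = 0`.
  have shift : ((fundamentalTangle j).act (π, c)).2 =
      c + ((fundamentalTangle j).act (π, 0)).2 := by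
    fin_cases j <;>
      simp [fundamentalTangle, Diagram.act, Diagram.single, Slice.act, add_assoc]
  rw [shift, key, ← apply_ite (c + ·)]

/-! ### The bracket matrix -/

/-- The value `exp (iπ/4)` of the variable of the Kauffman bracket. -/
noncomputable def root : ℂ := Complex.exp (Real.pi * Complex.I / 4)

theorem root_sq : root ^ 2 = Complex.I := by
  rw [root, ← Complex.exp_nat_mul,
    show ((2 : ℕ) : ℂ) * (Real.pi * Complex.I / 4) = Real.pi / 2 * Complex.I by push_cast; ring,
    Complex.exp_pi_div_two_mul_I]

theorem loop_value_eq_zero : -root ^ 2 - root⁻¹ ^ 2 = 0 := by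
  rw [inv_pow, root_sq, Complex.inv_I]
  ring

/-- The indicator function of a basic state. -/
noncomputable def indicator (j : Fin 2) (y : LoopState 4) : ℂ := if y = basicState j then 1 else 0

/-- The summand is a power of `0`, equal to `1` just when the exponent is `0`. Filling always yields
at least one circle, so this means exactly one, and truncated subtraction is harmless. -/
theorem stateSum_fundamentalTangle (j : Fin 2) :
    (fundamentalTangle j).stateSum root (fun y => (-root ^ 2 - root⁻¹ ^ 2) ^ (y.2 - 1)) =
      indicator j := by
  funext y
  have hj : (fundamentalTangle j).Crossingless := by
    fin_cases j <;>
      simp [fundamentalTangle, Diagram.single, Diagram.Crossingless, Slice.Crossingless]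
  have hb : (basicState j).2 = 0 := rfl
  rw [Diagram.stateSum_of_crossingless _ hj, act_fundamentalTangle_snd, loop_value_eq_zero,
    indicator]
  simp only [Prod.ext_iff, hb]
  by_cases h1 : y.1 = (basicState j).1 <;> by_cases h2 : y.2 = 0 <;> simp [h1, h2]

namespace ST

/-- The state sum of `S` with the endpoints of the two circles joined as in basic states. -/
noncomputable def entry (S : ST) (k j : Fin 2) : ℂ :=
  Diagram.stateSum root S (indicator j) (basicState k)

theorem bracket_link (S : ST) (k j : Fin 2) : bracket (S.link k j) = S.entry k j := by
  have hk : (closingArcs k).Crossingless := by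
    fin_cases k <;> simp [closingArcs, Diagram.single, Diagram.Crossingless, Slice.Crossingless]
  rw [bracket, ← root, Diagram.kauffmanBracket_eq_stateSum, link, Diagram.stateSum_glue,
    stateSum_fundamentalTangle, Diagram.stateSum_glue (D := (S : Diagram 4 4)),
    Diagram.stateSum_of_crossingless _ hk, act_closingArcs, entry]

theorem stateSum_indicator_of_ne_zero (S : ST) (j : Fin 2) {y : LoopState 4} (hy : y.2 ≠ 0) :
    Diagram.stateSum root S (indicator j) y = 0 := by
  refine Finset.sum_eq_zero fun σ _ => ?_
  have hle := Diagram.le_act_snd (Diagram.resolve S σ) y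
  rw [indicator, if_neg, mul_zero]
  intro h
  rw [h] at hle
  exact hy (Nat.le_zero.1 hle)

/-- On circle-free states the two indicators form a basis; elsewhere both sides vanish. -/
theorem stateSum_indicator (S : ST) (j : Fin 2) :
    Diagram.stateSum root S (indicator j) = fun y => ∑ t, S.entry t j * indicator t y := by
  funext y
  by_cases hy : y.2 = 0
  · obtain ⟨k, rfl⟩ := exists_eq_basicState hy
    simp [indicator, basicState_injective.eq_iff, entry]
  · rw [stateSum_indicator_of_ne_zero S j hy]
    refine (Finset.sum_eq_zero fun t _ => ?_).symm
    rw [indicator, if_neg, mul_zero]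
    rintro rfl
    exact hy rfl

theorem entry_comp (S₂ S₁ : ST) (k j : Fin 2) :
    (S₂.comp S₁).entry k j = ∑ t, S₂.entry k t * S₁.entry t j := by
  have h := Diagram.stateSum_glue root (S₁ : Diagram 4 4) (S₂ : Diagram 4 4) (indicator j)
  rw [stateSum_indicator] at h
  refine (congrFun h _).trans ((Diagram.stateSum_sum_mul root S₂ _ _ _).trans ?_)
  exact Finset.sum_congr rfl fun t _ => mul_comm _ _

/-- The bracket matrix is the matrix of entries conjugated by `diag(1, i)`. -/
theorem bracketMatrix_comp (S₂ S₁ : ST) :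
    (S₂.comp S₁).bracketMatrix = S₂.bracketMatrix * S₁.bracketMatrix := by
  simp only [bracketMatrix, bracket_link, entry_comp, Matrix.mul_fin_two, Fin.sum_univ_two]
  ext a b
  fin_cases a <;> fin_cases b <;> simp
  · linear_combination (S₂.entry 0 1 * S₁.entry 1 0) * Complex.I_sq
  · ring
  · ring
  · linear_combination (S₂.entry 1 0 * S₁.entry 0 1) * Complex.I_sq

theorem bracketMatrix_id : ST.id.bracketMatrix = 1 := by
  have h (k j : Fin 2) : ST.id.entry k j = if k = j then 1 else 0 := by
    rw [entry, ST.id, Diagram.stateSum_nil, indicator]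
    exact if_congr basicState_injective.eq_iff rfl rfl
  simp [bracketMatrix, bracket_link, h, Matrix.one_fin_two]

/-! ### Integrality and uniqueness up to sign -/

theorem hasPhase_indicator (j : Fin 2) :
    HasPhase (if j = 0 then 1 else -Complex.I) (indicator j) := by
  intro y
  by_cases h : y = basicState j
  · subst h
    refine ⟨1, ?_⟩
    have h0 : LoopState.sign (basicState 0) = 1 := by decide
    have h1 : LoopState.sign (basicState 1) = -1 := by decide
    fin_cases j <;> simp [indicator, phase, h0, h1]
  · exact ⟨0, by simp [indicator, h]⟩

theorem exists_bracketMatrix_eq (S : ST) : ∃ ζ : ℂ, ζ ^ 8 = 1 ∧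
    ∃ M : Matrix (Fin 2) (Fin 2) ℤ, S.bracketMatrix = ζ • M.map (fun a : ℤ => (a : ℂ)) := by
  obtain ⟨ζ, h1, h2⟩ := HasPhase.stateSum root_sq (S : Diagram 4 4)
  have h0 : LoopState.sign (basicState 0) = 1 := by decide
  have h1' : LoopState.sign (basicState 1) = -1 := by decide
  have hm (k j : Fin 2) := h2 _ _ (hasPhase_indicator j) (basicState k)
  choose m hm using hm
  -- Columns carry the phases `1, -i` and rows `1, i`; with the factors `∓i` of the bracket matrix
  -- only signs remain off the diagonal.
  refine ⟨ζ, h1, !![m 0 0, -m 0 1; -m 1 0, m 1 1], ?_⟩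
  have hm' : ∀ k j, S.entry k j = _ := hm
  rw [bracketMatrix]
  simp only [bracket_link, hm', h0, h1', phase]
  ext a b
  fin_cases a <;> fin_cases b <;> simp
  · linear_combination (ζ * m 0 1) * Complex.I_sq
  · linear_combination (ζ * m 1 0) * Complex.I_sq
  · linear_combination (-ζ * m 1 1) * Complex.I_sq

theorem invariantSet_eq {S : ST} {ζ : ℂ} (hζ : ζ ^ 8 = 1) {M : Matrix (Fin 2) (Fin 2) ℤ}
    (hM : S.bracketMatrix = ζ • M.map (fun a : ℤ => (a : ℂ))) :
    S.invariantSet = {N | N = M ∨ N = -M} := by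
  have hζ0 : ζ ≠ 0 := by rintro rfl; norm_num at hζ
  ext N
  constructor
  · rintro ⟨z, hz, hN⟩
    have hent (a b : Fin 2) : (N a b : ℂ) = z * ζ * M a b := by
      have := congrFun (congrFun hN a) b
      simpa [hM, mul_assoc] using this
    -- The zero matrix does not determine the ratio `z * ζ`, but then `N = 0` as well.
    by_cases hM0 : M = 0
    · left
      ext a b
      have := hent a b
      simpa [hM0] using this
    · obtain ⟨a, b, hab⟩ : ∃ a b, M a b ≠ 0 := by
        by_contra! h
        exact hM0 (Matrix.ext h)
      -- Eighth powers remove the roots of unity, and integers with equal eighth powers agree up to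
      -- sign; one nonzero entry fixes the ratio.
      have h8 : N a b ^ 8 = M a b ^ 8 := by
        have : (N a b : ℂ) ^ 8 = (M a b : ℂ) ^ 8 := by
          rw [hent, mul_pow, mul_pow, hz, hζ, one_mul, one_mul]
        exact_mod_cast this
      have hab' : (M a b : ℂ) ≠ 0 := Int.cast_ne_zero.2 hab
      have hw : z * ζ = 1 ∨ z * ζ = -1 := by
        rcases (pow_eq_pow_iff_of_ne_zero (by norm_num)).1 h8 with h | ⟨h, -⟩
        · left
          refine mul_right_cancel₀ hab' ?_
          rw [← hent, h, one_mul]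
        · right
          refine mul_right_cancel₀ hab' ?_
          rw [← hent, h]
          push_cast
          ring
      refine hw.imp (fun hw => ?_) (fun hw => ?_) <;> ext c d <;> have := hent c d <;>
        rw [hw] at this
      · exact_mod_cast this.trans (one_mul _)
      · rw [Matrix.neg_apply]
        exact_mod_cast this.trans (neg_one_mul _)
  · have hinv : (ζ⁻¹) ^ 8 = 1 := by rw [inv_pow, hζ, inv_one]
    rintro (rfl | rfl)
    · exact ⟨ζ⁻¹, hinv, by rw [hM, smul_smul, inv_mul_cancel₀ hζ0, one_smul]⟩
    · refine ⟨-ζ⁻¹, by rw [Even.neg_pow (by decide), hinv], ?_⟩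
      rw [hM, smul_smul, neg_mul, inv_mul_cancel₀ hζ0, neg_smul, one_smul]
      ext a b
      simp

end ST

/-! ### The class of the invariant set -/

theorem PM.toSet_coe (M : Matrix (Fin 2) (Fin 2) ℤ) :
    PM.toSet (Con.toQuotient (c := signCon) M) = {N | N = M ∨ N = -M} := by
  ext N
  exact Con.eq signCon

/-- The choice in `F` is justified by a class that does have the invariant set as its set of
representatives. -/
theorem toSet_F (S : ST) : PM.toSet (F S) = S.invariantSet := by
  obtain ⟨ζ, hζ, M, hM⟩ := S.exists_bracketMatrix_eq
  exact Classical.epsilon_spec (p := fun P : PM => P.toSet = S.invariantSet)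
    ⟨Con.toQuotient (c := signCon) M, by rw [PM.toSet_coe, ST.invariantSet_eq hζ hM]⟩

theorem F_eq {S : ST} {ζ : ℂ} (hζ : ζ ^ 8 = 1) {M : Matrix (Fin 2) (Fin 2) ℤ}
    (hM : S.bracketMatrix = ζ • M.map (fun a : ℤ => (a : ℂ))) :
    F S = Con.toQuotient (c := signCon) M := by
  have h : M ∈ PM.toSet (F S) := by
    rw [toSet_F, ST.invariantSet_eq hζ hM]
    exact Or.inl rfl
  exact h.symm

theorem F_comp (S₂ S₁ : ST) : F (S₂.comp S₁) = F S₂ * F S₁ := by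
  obtain ⟨ζ₁, hζ₁, M₁, hM₁⟩ := S₁.exists_bracketMatrix_eq
  obtain ⟨ζ₂, hζ₂, M₂, hM₂⟩ := S₂.exists_bracketMatrix_eq
  rw [F_eq hζ₁ hM₁, F_eq hζ₂ hM₂, F_eq (ζ := ζ₂ * ζ₁) (M := M₂ * M₁)
    (by rw [mul_pow, hζ₁, hζ₂, one_mul])]
  · rfl
  · rw [ST.bracketMatrix_comp, hM₁, hM₂, Matrix.smul_mul, Matrix.mul_smul, smul_smul]
    congr 1
    exact (Matrix.map_mul (f := Int.castRingHom ℂ)).symm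

theorem F_id : F ST.id = 1 := by
  refine F_eq (ζ := 1) (M := 1) (one_pow 8) ?_
  rw [ST.bracketMatrix_id, one_smul]
  exact (Matrix.map_one (Int.castRingHom ℂ) (map_zero _) (map_one _)).symm

end BallTangle

open BallTangle in
/-- The first clause says that `F` is well defined with values in `PM_{2×2}(ℤ)`. -/
theorem lemma4p8 :
    (∀ S : ST, PM.toSet (F S) = S.invariantSet) ∧
    (∀ S₁ S₂ : ST, F (S₂.comp S₁) = F S₂ * F S₁) ∧
    (∃ φ : ST →* PM, ∀ S : ST, φ S = F S) :=
  ⟨toSet_F, fun S₁ S₂ => F_comp S₂ S₁,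
    { toFun := F, map_one' := F_id, map_mul' := F_comp }, fun _ => rfl⟩
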